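/- Let $X$ be a smooth projective variety over $\mathbb C$, let $L$ be a line bundle on $X$, let $0\neq s\in H^0(X,L)$ and let $v\in H^1(X,\mathcal O_X)$. Assume that $v$ is $1$-transversal to $L$, i.e. that the complex $$H^0(X,L)\xrightarrow{\ \cup v\ }H^1(X,L)\xrightarrow{\ \cup v\ }H^2(X,L)$$ is exact (at $H^1(X,L)$), and that $s\cup v=0$ in $H^1(X,L)$. A formal deformation of $L$ over $\mathbb C[[t]]$ is an invertible sheaf $\mathcal L$ on the formal scheme $X\times\operatorname{Spf}\mathbb C[[t]]$ (i.e. an invertible module over the sheaf of rings $\mathcal O_X[[t]]$ on $X$) together with an isomorphism $\mathcal L/t\mathcal L\cong L$; a formal deformation of the pair $(s,L)$ consists of a formal deformation of $L$ and a global section $s(t)$ of $\mathcal L$ whose restriction to $t=0$ is $s$. The formal straight line deformation $L_v(t)=L\otimes\exp(tv)$ of $L$ in the direction $v$ is obtained as follows: if $\{U_i\}$ is an affine open cover of $X$ and $(a_{ij})$, $a_{ij}\in\mathcal O_X(U_i\cap U_j)$, is a cocycle representing $v$, then $L_v(t)$ is glued from the sheaves $L|_{U_i}[[t]]$ by the transition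 functions $\exp(ta_{ij})=\sum_{n\ge 0}a_{ij}^n t^n/n!$, so that its sections over an open set $W$ are the families $s_i(t)\in L(W\cap U_i)[[t]]$ with $s_i(t)=\exp(ta_{ij})\,s_j(t)$ on $W\cap U_i\cap U_j$. Then the formal straight line deformation $L_v(t)$ of $L$ lifts to a formal deformation $(s_v(t),L_v(t))$ of the pair $(s,L)$: there is a global section $s_v(t)$ of $L_v(t)$ which restricts to $s$ at $t=0$. -/

import Mathlib

open CategoryTheory AlgebraicGeometry Opposite

noncomputable section

namespace FormalLift

section Variety

attribute [local instance] MvPolynomial.gradedAlgebra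

/-- Projective `n`-space over `ℂ`. -/
def projectiveSpace (n : ℕ) : Scheme.{0} :=
  Proj (MvPolynomial.homogeneousSubmodule (Fin (n + 1)) ℂ)

/-- The structure morphism `ℙⁿ ⟶ Spec ℂ`. -/
def projectiveSpaceToSpec (n : ℕ) : projectiveSpace n ⟶ Spec (.of ℂ) :=
  Proj.toSpecZero (MvPolynomial.homogeneousSubmodule (Fin (n + 1)) ℂ) ≫
    Spec.map (CommRingCat.ofHom
      (algebraMap ℂ (MvPolynomial.homogeneousSubmodule (Fin (n + 1)) ℂ 0)))

/-- `f : X ⟶ Spec ℂ` makes `X` a smooth (integral) projective variety over `ℂ`. -/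
structure IsSmoothProjectiveVariety {X : Scheme.{0}} (f : X ⟶ Spec (.of ℂ)) : Prop where
  smooth : Smooth f
  integral : IsIntegral X
  projective : ∃ (n : ℕ) (i : X ⟶ projectiveSpace n),
    IsClosedImmersion i ∧ i ≫ projectiveSpaceToSpec n = f

end Variety

/-! ### Line bundles -/

/-- An invertible sheaf over a sheaf of rings `R` on a topological space: locally there is a section
`e` such that `r ↦ r • e` is an isomorphism from `R` onto the sheaf. -/
def IsInvertible {X : TopCat.{0}} {R : TopCat.Sheaf RingCat.{0} X} (M : SheafOfModules.{0} R) :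
    Prop :=
  ∀ x : X, ∃ (U : TopologicalSpace.Opens X) (_ : x ∈ U) (e : M.val.obj (op U)),
    ∀ (V : TopologicalSpace.Opens X) (h : V ≤ U),
      Function.Bijective fun r : R.obj.obj (op V) ↦
        r • (show M.val.obj (op V) from M.val.map (homOfLE h).op e)

variable {X : Scheme.{0}}

/-- A line bundle on the scheme `X`. -/
def IsLineBundle (L : X.Modules) : Prop :=
  IsInvertible (R := X.ringCatSheaf) L

/-! ### Restriction of sections -/

/-- Restriction of sections of an `𝒪_X`-module. -/
def res (F : X.Modules) {V W : X.Opens} (h : V ≤ W) : Γ(F, W) →+ Γ(F, V) :=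
  (F.presheaf.map (homOfLE h).op).hom

/-- Restriction of functions. -/
def resO {V W : X.Opens} (h : V ≤ W) : Γ(X, W) →+* Γ(X, V) :=
  (X.presheaf.map (homOfLE h).op).hom

lemma res_res (F : X.Modules) {U V W : X.Opens} (h : U ≤ V) (h' : V ≤ W) (x : Γ(F, W)) :
    res F h (res F h' x) = res F (h.trans h') x := by
  simp only [res]
  rw [← AddMonoidHom.comp_apply, ← AddCommGrpCat.hom_comp, ← Functor.map_comp]
  rfl

lemma res_self (F : X.Modules) {U : X.Opens} (h : U ≤ U) (x : Γ(F, U)) : res F h x = x := by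
  simp only [res]
  have : (homOfLE h).op = 𝟙 (op U) := rfl
  rw [this, F.presheaf.map_id]; rfl

lemma resO_resO {U V W : X.Opens} (h : U ≤ V) (h' : V ≤ W) (x : Γ(X, W)) :
    resO h (resO h' x) = resO (h.trans h') x := by
  simp only [resO]
  rw [← RingHom.comp_apply, ← CommRingCat.hom_comp, ← Functor.map_comp]
  rfl

lemma res_smul (F : X.Modules) {V W : X.Opens} (h : V ≤ W) (r : Γ(X, W)) (x : Γ(F, W)) :
    res F h (r • x) = resO h r • res F h x :=
  F.map_smul (homOfLE h) r x

/-! ### Čech cohomology -/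

variable {ι : Type}

/-- Čech `k`-cochains of `F` with respect to the family of opens `U`. -/
abbrev Cochain (U : ι → X.Opens) (F : X.Modules) (k : ℕ) : Type :=
  ∀ i : Fin (k + 1) → ι, Γ(F, ⨅ j, U (i j))

variable {U : ι → X.Opens} {F : X.Modules}

/-- The value of a cochain at the tuple `i`, restricted to an open `W` contained in every
`U (i j)`. -/
def Cochain.ev {k : ℕ} (c : Cochain U F k) (i : Fin (k + 1) → ι) (W : X.Opens)
    (h : ∀ j, W ≤ U (i j)) : Γ(F, W) :=
  res F (le_iInf h) (c i)

lemma pair_le {W : X.Opens} {i j : ι} (hi : W ≤ U i) (hj : W ≤ U j) (m : Fin 2) :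
    W ≤ U (![i, j] m) := by
  fin_cases m <;> assumption

/-- The structure sheaf `𝒪_X` as a module over itself. -/
def structureModule (X : Scheme.{0}) : X.Modules := SheafOfModules.unit X.ringCatSheaf

/-- A section of `𝒪_X`, as an element of the ring of functions. -/
def toFun {W : X.Opens} (a : Γ(structureModule X, W)) : Γ(X, W) := a

lemma toFun_res {V W : X.Opens} (h : V ≤ W) (a : Γ(structureModule X, W)) :
    toFun (res _ h a) = resO h (toFun a) := rfl

lemma toFun_add {W : X.Opens} (a b : Γ(structureModule X, W)) :
    toFun (a + b) = toFun a + toFun b := rfl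

lemma ev_congr {k : ℕ} (c : Cochain U F k) {i i' : Fin (k + 1) → ι} (e : i = i') (W : X.Opens)
    (h : ∀ j, W ≤ U (i j)) (h' : ∀ j, W ≤ U (i' j)) : c.ev i W h = c.ev i' W h' := by
  subst e; rfl

lemma res_ev {k : ℕ} (c : Cochain U F k) (i : Fin (k + 1) → ι) {V W : X.Opens} (hV : V ≤ W)
    (h : ∀ j, W ≤ U (i j)) : res F hV (c.ev i W h) = c.ev i V fun j ↦ hV.trans (h j) :=
  res_res _ _ _ _

lemma ev_add {k : ℕ} (c c' : Cochain U F k) (i : Fin (k + 1) → ι) (W : X.Opens)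
    (h : ∀ j, W ≤ U (i j)) : Cochain.ev (c + c') i W h = c.ev i W h + c'.ev i W h :=
  map_add _ _ _

lemma eq_ev {k : ℕ} (c : Cochain U F k) (i : Fin (k + 1) → ι) :
    c i = c.ev i _ (iInf_le _) := (res_self _ _ _).symm

/-- The Čech differential
`(d c)(i₀, …, i_{k+1}) = ∑ⱼ (-1)ʲ c(i₀, …, îⱼ, …, i_{k+1})`. -/
def cechD (U : ι → X.Opens) (F : X.Modules) (k : ℕ) : Cochain U F k →+ Cochain U F (k + 1) where
  toFun c i := ∑ j : Fin (k + 2),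
    (-1 : ℤ) ^ (j : ℕ) • c.ev (i ∘ j.succAbove) (⨅ j, U (i j)) fun l ↦ iInf_le _ (j.succAbove l)
  map_zero' := by
    funext i
    refine Finset.sum_eq_zero fun j _ ↦ ?_
    rw [show Cochain.ev (0 : Cochain U F k) _ _ _ = 0 from map_zero (res F _), smul_zero]
  map_add' c c' := by
    funext i
    simp only [ev_add, smul_add, Finset.sum_add_distrib, Pi.add_apply]

/-- Čech cocycles. -/
def cocycles (U : ι → X.Opens) (F : X.Modules) (k : ℕ) : AddSubgroup (Cochain U F k) :=
  (cechD U F k).ker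

/-- Čech coboundaries. -/
def coboundaries (U : ι → X.Opens) (F : X.Modules) : (k : ℕ) → AddSubgroup (Cochain U F k)
  | 0 => ⊥
  | k + 1 => (cechD U F k).range

/-- The Čech cohomology group `Hᵏ(𝔘, F)`. For an affine open cover of a separated scheme and a
quasi-coherent `F` this is the cohomology `Hᵏ(X, F)`. -/
def H (U : ι → X.Opens) (F : X.Modules) (k : ℕ) : Type :=
  cocycles U F k ⧸ (coboundaries U F k).addSubgroupOf (cocycles U F k)

instance (k : ℕ) : AddCommGroup (H U F k) :=
  QuotientAddGroup.Quotient.addCommGroup _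

/-- The cohomology class of a cocycle. -/
def cls {k : ℕ} : cocycles U F k →+ H U F k := QuotientAddGroup.mk' _

/-! ### Cup product -/

lemma ev_cechD {k : ℕ} (c : Cochain U F k) (i : Fin (k + 2) → ι) (W : X.Opens)
    (h : ∀ j, W ≤ U (i j)) :
    (cechD U F k c).ev i W h = ∑ j : Fin (k + 2),
      (-1 : ℤ) ^ (j : ℕ) • c.ev (i ∘ j.succAbove) W fun l ↦ h (j.succAbove l) := by
  change res F _ (∑ j : Fin (k + 2), _) = _
  rw [map_sum]
  refine Finset.sum_congr rfl fun j _ ↦ ?_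
  rw [map_zsmul, res_ev]

/-- The product of a `0`-cochain of `𝒪_X` with a `k`-cochain of `F`. -/
def cup₀ (b : Cochain U (structureModule X) 0) {k : ℕ} : Cochain U F k →+ Cochain U F k where
  toFun c i := toFun (b.ev (fun _ ↦ i 0) (⨅ j, U (i j)) fun _ ↦ iInf_le _ 0) • c i
  map_zero' := by funext i; exact smul_zero _
  map_add' c c' := by funext i; exact smul_add _ _ _

/-- The cup product of a `1`-cochain `a` of `𝒪_X` with a `k`-cochain `c` of `F`:
`(a ∪ c)(i₀, …, i_{k+1}) = a(i₀, i₁) c(i₁, …, i_{k+1})`. -/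
def cup₁ {k : ℕ} (a : Cochain U (structureModule X) 1) :
    Cochain U F k →+ Cochain U F (k + 1) where
  toFun c i :=
    toFun (a.ev ![i 0, i 1] (⨅ j, U (i j)) (pair_le (iInf_le _ 0) (iInf_le _ 1))) •
      c.ev (i ∘ Fin.succ) (⨅ j, U (i j)) fun l ↦ iInf_le _ l.succ
  map_zero' := by
    funext i
    rw [show Cochain.ev (0 : Cochain U F k) _ _ _ = 0 from map_zero (res F _)]
    exact smul_zero _
  map_add' c c' := by funext i; rw [ev_add]; exact smul_add _ _ _

lemma ev_cup₀ {k : ℕ} (b : Cochain U (structureModule X) 0) (c : Cochain U F k)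
    (i : Fin (k + 1) → ι) (W : X.Opens) (h : ∀ j, W ≤ U (i j)) :
    (cup₀ b c).ev i W h = toFun (b.ev (fun _ ↦ i 0) W fun _ ↦ h 0) • c.ev i W h := by
  refine (res_smul F (le_iInf h) _ _).trans ?_
  rw [← toFun_res, res_ev]; rfl

lemma ev_cup₁ {k : ℕ} (a : Cochain U (structureModule X) 1) (c : Cochain U F k)
    (i : Fin (k + 2) → ι) (W : X.Opens) (h : ∀ j, W ≤ U (i j)) :
    (cup₁ a c).ev i W h = toFun (a.ev ![i 0, i 1] W (pair_le (h 0) (h 1))) •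
      c.ev (i ∘ Fin.succ) W fun l ↦ h l.succ := by
  refine (res_smul F (le_iInf h) _ _).trans ?_
  rw [← toFun_res, res_ev, res_ev]

/-- The cocycle condition `a(i, l) = a(i, j) + a(j, l)`. -/
lemma cocycle_add {a : Cochain U (structureModule X) 1} (ha : a ∈ cocycles U (structureModule X) 1)
    (i j l : ι) (W : X.Opens) (hi : W ≤ U i) (hj : W ≤ U j) (hl : W ≤ U l) :
    a.ev ![i, l] W (pair_le hi hl) =
      a.ev ![i, j] W (pair_le hi hj) +
        a.ev ![j, l] W (pair_le hj hl) := by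
  have hW : ∀ m, W ≤ U (![i, j, l] m) := by
    intro m; fin_cases m <;> assumption
  have h := ev_cechD a ![i, j, l] W hW
  rw [show cechD U (structureModule X) 1 a = 0 from ha] at h
  rw [show Cochain.ev (0 : Cochain U (structureModule X) 2) _ _ _ = 0 from map_zero (res _ _)] at h
  rw [Fin.sum_univ_three] at h
  simp only [Fin.val_zero, pow_zero, one_smul, Fin.val_one, pow_one, neg_smul, Fin.val_two,
    neg_one_sq] at h
  rw [ev_congr a (i' := ![j, l]) (by ext m; fin_cases m <;> rfl) W _
      (pair_le hj hl),
    ev_congr a (i := ![i, j, l] ∘ Fin.succAbove 1) (i' := ![i, l])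
      (by ext m; fin_cases m <;> rfl) W _ (pair_le hi hl),
    ev_congr a (i := ![i, j, l] ∘ Fin.succAbove 2) (i' := ![i, j])
      (by ext m; fin_cases m <;> rfl) W _ (pair_le hi hj)] at h
  rw [eq_comm, ← sub_eq_zero, h]; abel


lemma ev_cechD_cup₁ {k : ℕ} {a : Cochain U (structureModule X) 1}
    (ha : a ∈ cocycles U (structureModule X) 1) (c : Cochain U F k) (i : Fin (k + 3) → ι)
    (W : X.Opens) (h : ∀ j, W ≤ U (i j)) :
    (cechD U F (k + 1) (cup₁ a c)).ev i W h = - (cup₁ a (cechD U F k c)).ev i W h := by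
  have e0 : (cup₁ a c).ev (i ∘ Fin.succAbove 0) W (fun l ↦ h _) =
      toFun (a.ev ![i 1, i 2] W (pair_le (h 1) (h 2))) •
        c.ev (i ∘ Fin.succ ∘ Fin.succ) W fun l ↦ h _ := by
    rw [ev_cup₁]; rfl
  have e1 : (cup₁ a c).ev (i ∘ Fin.succAbove (Fin.succ 0)) W (fun l ↦ h _) =
      toFun (a.ev ![i 0, i 2] W (pair_le (h 0) (h 2))) •
        c.ev (i ∘ Fin.succ ∘ Fin.succ) W fun l ↦ h _ := by
    rw [ev_cup₁]
    congr 1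
  have e2 : ∀ m : Fin (k + 1), (cup₁ a c).ev (i ∘ Fin.succAbove m.succ.succ) W (fun l ↦ h _) =
      toFun (a.ev ![i 0, i 1] W (pair_le (h 0) (h 1))) •
        c.ev ((i ∘ Fin.succ) ∘ Fin.succAbove m.succ) W fun l ↦ h _ := by
    intro m
    rw [ev_cup₁]
    congr 1
    refine ev_congr c ?_ W _ _
    funext l; simp
  have e3 : c.ev ((i ∘ Fin.succ) ∘ Fin.succAbove 0) W (fun l ↦ h _) =
      c.ev (i ∘ Fin.succ ∘ Fin.succ) W fun l ↦ h _ := rfl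
  have key := cocycle_add ha (i 0) (i 1) (i 2) W (h 0) (h 1) (h 2)
  rw [ev_cechD, ev_cup₁, ev_cechD, Fin.sum_univ_succ, Fin.sum_univ_succ,
    Fin.sum_univ_succ (n := k + 1)]
  simp only [e0, e1, e2, e3, key]
  generalize a.ev ![i 0, i 1] W _ = p
  generalize a.ev ![i 1, i 2] W _ = q
  generalize c.ev (i ∘ Fin.succ ∘ Fin.succ) W _ = y
  have e4 : ∑ m : Fin (k + 1), (-1 : ℤ) ^ (m.succ.succ : ℕ) • toFun p •
        c.ev ((i ∘ Fin.succ) ∘ Fin.succAbove m.succ) W (fun l ↦ h _) =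
      - (toFun p • ∑ m : Fin (k + 1), (-1 : ℤ) ^ (m.succ : ℕ) •
        c.ev ((i ∘ Fin.succ) ∘ Fin.succAbove m.succ) W (fun l ↦ h _)) := by
    rw [Finset.smul_sum, ← Finset.sum_neg_distrib]
    refine Finset.sum_congr rfl fun m _ ↦ ?_
    rw [Fin.val_succ, pow_succ, smul_comm (toFun p)]
    simp
  rw [e4, smul_add, toFun_add, add_smul]
  simp only [Fin.val_succ, Fin.val_zero, pow_zero, one_smul, zero_add, pow_one, neg_smul]
  abel

/-- The Leibniz rule `d (a ∪ c) = - a ∪ d c` for a cocycle `a`. -/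
lemma cechD_cup₁ {k : ℕ} {a : Cochain U (structureModule X) 1}
    (ha : a ∈ cocycles U (structureModule X) 1) (c : Cochain U F k) :
    cechD U F (k + 1) (cup₁ a c) = - cup₁ a (cechD U F k c) := by
  funext i
  rw [eq_ev (cechD U F (k + 1) (cup₁ a c)) i, Pi.neg_apply, eq_ev (cup₁ a (cechD U F k c)) i]
  exact ev_cechD_cup₁ ha c i _ _

lemma ev_cechD_cup₀ {k : ℕ} (b : Cochain U (structureModule X) 0) {c : Cochain U F k}
    (hc : c ∈ cocycles U F k) (i : Fin (k + 2) → ι) (W : X.Opens) (h : ∀ j, W ≤ U (i j)) :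
    (cechD U F k (cup₀ b c)).ev i W h =
      (cup₁ (cechD U (structureModule X) 0 b) c).ev i W h := by
  have hc' := ev_cechD c i W h
  rw [show cechD U F k c = 0 from hc,
    show Cochain.ev (0 : Cochain U F (k + 1)) _ _ _ = 0 from map_zero (res _ _),
    Fin.sum_univ_succ] at hc'
  rw [ev_cechD, ev_cup₁, ev_cechD, Fin.sum_univ_succ, Fin.sum_univ_two]
  have e0 : (cup₀ b c).ev (i ∘ Fin.succAbove 0) W (fun l ↦ h _) =
      toFun (b.ev (fun _ ↦ i 1) W fun _ ↦ h 1) • c.ev (i ∘ Fin.succ) W fun l ↦ h _ := by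
    rw [ev_cup₀]; rfl
  have e1 : ∀ m : Fin (k + 1), (cup₀ b c).ev (i ∘ Fin.succAbove m.succ) W (fun l ↦ h _) =
      toFun (b.ev (fun _ ↦ i 0) W fun _ ↦ h 0) •
        c.ev (i ∘ Fin.succAbove m.succ) W fun l ↦ h _ := by
    intro m
    rw [ev_cup₀]; rfl
  have e2 : b.ev (![i 0, i 1] ∘ Fin.succAbove 0) W (fun l ↦ pair_le (h 0) (h 1) _) =
      b.ev (fun _ ↦ i 1) W fun _ ↦ h 1 := ev_congr b (by ext m; fin_cases m; rfl) W _ _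
  have e3 : b.ev (![i 0, i 1] ∘ Fin.succAbove 1) W (fun l ↦ pair_le (h 0) (h 1) _) =
      b.ev (fun _ ↦ i 0) W fun _ ↦ h 0 := ev_congr b (by ext m; fin_cases m; rfl) W _ _
  have e5 : c.ev (i ∘ Fin.succAbove 0) W (fun l ↦ h _) = c.ev (i ∘ Fin.succ) W fun l ↦ h _ := rfl
  simp only [e0, e1, e2, e3]
  rw [e5] at hc'
  generalize b.ev (fun _ ↦ i 0) W _ = p
  generalize b.ev (fun _ ↦ i 1) W _ = q
  have e4 : ∑ m : Fin (k + 1), (-1 : ℤ) ^ (m.succ : ℕ) • toFun p •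
        c.ev (i ∘ Fin.succAbove m.succ) W (fun l ↦ h _) =
      toFun p • ∑ m : Fin (k + 1), (-1 : ℤ) ^ (m.succ : ℕ) •
        c.ev (i ∘ Fin.succAbove m.succ) W (fun l ↦ h _) := by
    rw [Finset.smul_sum]
    refine Finset.sum_congr rfl fun m _ ↦ ?_
    rw [smul_comm (toFun p)]
  have e6 : toFun ((-1 : ℤ) ^ ((0 : Fin 2) : ℕ) • q + (-1 : ℤ) ^ ((1 : Fin 2) : ℕ) • p) =
      toFun q - toFun p := by
    simp only [Fin.val_zero, pow_zero, one_smul, Fin.val_one, pow_one, neg_smul]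
    exact (sub_eq_add_neg _ _).symm
  rw [e4, e6, sub_smul]
  simp only [Fin.val_zero, pow_zero, one_smul] at hc' ⊢
  rw [← sub_eq_zero, sub_sub_eq_add_sub, add_assoc, add_comm, ]
  have := congrArg (toFun p • ·) hc'
  simp only [smul_zero, smul_add] at this
  rw [eq_comm] at this
  rw [← this]; abel

/-- The Leibniz rule `d (b c) = d b ∪ c` for a `0`-cochain `b` and a cocycle `c`. -/
lemma cechD_cup₀ {k : ℕ} (b : Cochain U (structureModule X) 0) {c : Cochain U F k}
    (hc : c ∈ cocycles U F k) :
    cechD U F k (cup₀ b c) = cup₁ (cechD U (structureModule X) 0 b) c := by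
  funext i
  rw [eq_ev (cechD U F k (cup₀ b c)) i, eq_ev (cup₁ _ c) i]
  exact ev_cechD_cup₀ b hc i _ _

lemma cup₁_add {k : ℕ} (a a' : Cochain U (structureModule X) 1) (c : Cochain U F k) :
    cup₁ (a + a') c = cup₁ a c + cup₁ a' c := by
  funext i
  rw [eq_ev (cup₁ (a + a') c) i, Pi.add_apply, eq_ev (cup₁ a c) i, eq_ev (cup₁ a' c) i]
  simp only [ev_cup₁, ev_add, toFun_add, add_smul]

lemma cup₁_mem {k : ℕ} {a : Cochain U (structureModule X) 1}
    (ha : a ∈ cocycles U (structureModule X) 1) {c : Cochain U F k} (hc : c ∈ cocycles U F k) :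
    cup₁ a c ∈ cocycles U F (k + 1) := by
  change cechD U F (k + 1) (cup₁ a c) = 0
  rw [cechD_cup₁ ha, show cechD U F k c = 0 from hc, map_zero, neg_zero]

/-- The cup product on cocycles, with values in cohomology. -/
def cupCocycle (U : ι → X.Opens) (F : X.Modules) (k : ℕ) :
    cocycles U (structureModule X) 1 →+ cocycles U F k →+ H U F (k + 1) :=
  AddMonoidHom.mk' (fun a ↦ AddMonoidHom.mk' (fun c ↦ cls ⟨cup₁ a.1 c.1, cup₁_mem a.2 c.2⟩)
      fun c c' ↦ by
        rw [← map_add]; congr 1; exact Subtype.ext (map_add (cup₁ a.1) c.1 c'.1))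
    fun a a' ↦ by
      ext c
      change cls _ = cls _ + cls _
      rw [← map_add]; congr 1; exact Subtype.ext (cup₁_add a.1 a'.1 c.1)

lemma cls_eq_zero {k : ℕ} (c : cocycles U F k) : cls c = 0 ↔ c.1 ∈ coboundaries U F k :=
  (QuotientAddGroup.eq_zero_iff c).trans AddSubgroup.mem_addSubgroupOf

lemma cupCocycle_coboundary_right {k : ℕ} (a : cocycles U (structureModule X) 1)
    (c : cocycles U F k) (hc : c.1 ∈ coboundaries U F k) : cupCocycle U F k a c = 0 := by
  refine (cls_eq_zero _).2 ?_
  cases k with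
  | zero =>
    change cup₁ a.1 c.1 ∈ _
    rw [show c.1 = 0 from hc, map_zero]
    exact zero_mem _
  | succ k =>
    obtain ⟨e, he⟩ := hc
    refine ⟨- cup₁ a.1 e, ?_⟩
    rw [map_neg, cechD_cup₁ a.2, neg_neg, he]

lemma cupCocycle_coboundary_left {k : ℕ} (a : cocycles U (structureModule X) 1)
    (ha : a.1 ∈ coboundaries U (structureModule X) 1) (c : cocycles U F k) :
    cupCocycle U F k a c = 0 := by
  refine (cls_eq_zero _).2 ?_
  obtain ⟨b, hb⟩ := ha
  exact ⟨cup₀ b c.1, by rw [cechD_cup₀ b c.2, hb]⟩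

/-- The cup product `H¹(𝒪_X) × Hᵏ(F) → Hᵏ⁺¹(F)`. -/
def cup (U : ι → X.Opens) (F : X.Modules) (k : ℕ) :
    H U (structureModule X) 1 →+ H U F k →+ H U F (k + 1) :=
  QuotientAddGroup.lift _
    (AddMonoidHom.mk' (fun a ↦ QuotientAddGroup.lift _ (cupCocycle U F k a)
        fun c hc ↦ cupCocycle_coboundary_right a c (AddSubgroup.mem_addSubgroupOf.1 hc))
      fun a a' ↦ by
        refine AddMonoidHom.ext fun x ↦ QuotientAddGroup.induction_on x fun c ↦ ?_
        change cupCocycle U F k (a + a') c = cupCocycle U F k a c + cupCocycle U F k a' c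
        rw [map_add]; rfl)
    fun a ha ↦ by
      refine AddMonoidHom.ext fun x ↦ QuotientAddGroup.induction_on x fun c ↦ ?_
      exact cupCocycle_coboundary_left a (AddSubgroup.mem_addSubgroupOf.1 ha) c

/-- `v` is `k`-transversal to `L`: the `k`-th cohomology of the complex
`0 → H⁰(L) → H¹(L) → ⋯` with differential the cup product with `v` vanishes. -/
def IsTransversal (U : ι → X.Opens) (L : X.Modules) (v : H U (structureModule X) 1) : ℕ → Prop
  | 0 => Function.Injective (cup U L 0 v)
  | k + 1 => Function.Exact (cup U L k v) (cup U L (k + 1) v)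

lemma const_mem (s : Γ(F, ⊤)) :
    (fun _ ↦ res F le_top s : Cochain U F 0) ∈ cocycles U F 0 := by
  change cechD U F 0 _ = 0
  funext i
  rw [eq_ev (cechD U F 0 _) i, ev_cechD, Fin.sum_univ_two]
  simp only [Cochain.ev, res_res]
  simp

/-- A global section of `F` as an element of `H⁰(F)`. -/
def globalClass (U : ι → X.Opens) (F : X.Modules) (s : Γ(F, ⊤)) : H U F 0 :=
  cls ⟨fun _ ↦ res F le_top s, const_mem s⟩

/-! ### Formal power series with coefficients in a module -/

/-- `M[[t]]`: formal power series with coefficients in `M`. -/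
def Formal (M : Type) : Type := ℕ → M

instance (M : Type) [AddCommGroup M] : AddCommGroup (Formal M) :=
  inferInstanceAs (AddCommGroup (ℕ → M))

open Finset in
/-- The action of `A[[t]]` on `M[[t]]` by multiplication of power series. -/
instance (A M : Type) [CommRing A] [AddCommGroup M] [Module A M] :
    Module (PowerSeries A) (Formal M) where
  smul f m := fun n ↦ ∑ p ∈ antidiagonal n, PowerSeries.coeff p.1 f • m p.2
  one_smul m := by
    funext n
    change ∑ p ∈ antidiagonal n, PowerSeries.coeff p.1 1 • m p.2 = m n
    rw [Nat.sum_antidiagonal_eq_sum_range_succ_mk, Finset.sum_range_succ', ]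
    simp [PowerSeries.coeff_one]
  mul_smul f g m := by
    funext n
    change ∑ p ∈ antidiagonal n, PowerSeries.coeff p.1 (f * g) • m p.2 =
      ∑ p ∈ antidiagonal n, PowerSeries.coeff p.1 f •
        ∑ q ∈ antidiagonal p.2, PowerSeries.coeff q.1 g • m q.2
    simp only [PowerSeries.coeff_mul, Finset.sum_smul, Finset.smul_sum, mul_smul]
    rw [Finset.sum_sigma', Finset.sum_sigma']
    refine Finset.sum_nbij' (fun ⟨⟨_, j⟩, ⟨k, l⟩⟩ ↦ ⟨(k, l + j), (l, j)⟩)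
      (fun ⟨⟨i, _⟩, ⟨k, l⟩⟩ ↦ ⟨(i + k, l), (i, k)⟩) ?_ ?_ ?_ ?_ ?_ <;>
      simp +contextual [add_assoc]
    intro a h h'
    lia
  smul_zero f := by
    funext n
    exact Finset.sum_eq_zero fun p _ ↦ smul_zero _
  smul_add f m m' := by
    funext n
    exact (Finset.sum_congr rfl fun p _ ↦ smul_add _ _ _).trans Finset.sum_add_distrib
  add_smul f g m := by
    funext n
    refine (Finset.sum_congr rfl fun p _ ↦ ?_).trans Finset.sum_add_distrib
    rw [map_add, add_smul]
  zero_smul m := by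
    funext n
    refine Finset.sum_eq_zero fun p _ ↦ ?_
    rw [map_zero, zero_smul]

lemma formal_smul_apply {A M : Type} [CommRing A] [AddCommGroup M] [Module A M]
    (f : PowerSeries A) (m : Formal M) (n : ℕ) :
    (f • m) n = ∑ p ∈ Finset.HasAntidiagonal.antidiagonal n, PowerSeries.coeff p.1 f • m p.2 := rfl

/-- Coefficientwise restriction of `L[[t]]`. -/
def resF (F : X.Modules) {V W : X.Opens} (h : V ≤ W) : Formal Γ(F, W) →+ Formal Γ(F, V) where
  toFun m := fun n ↦ res F h (m n)
  map_zero' := by funext n; exact map_zero _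
  map_add' m m' := by funext n; exact map_add _ _ _

lemma resF_resF (F : X.Modules) {U V W : X.Opens} (h : U ≤ V) (h' : V ≤ W)
    (x : Formal Γ(F, W)) : resF F h (resF F h' x) = resF F (h.trans h') x := by
  funext n; exact res_res _ _ _ _

lemma resF_self (F : X.Modules) {U : X.Opens} (h : U ≤ U) (x : Formal Γ(F, U)) :
    resF F h x = x := by
  funext n; exact res_self _ _ _

lemma resF_smul (F : X.Modules) {V W : X.Opens} (h : V ≤ W) (f : PowerSeries Γ(X, W))
    (x : Formal Γ(F, W)) : resF F h (f • x) = PowerSeries.map (resO h) f • resF F h x := by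
  funext n
  change res F h (∑ p ∈ Finset.HasAntidiagonal.antidiagonal n, PowerSeries.coeff p.1 f • x p.2) = _
  rw [map_sum, formal_smul_apply]
  refine Finset.sum_congr rfl fun p _ ↦ ?_
  rw [res_smul, PowerSeries.coeff_map]; rfl

lemma map_resO_resO {U V W : X.Opens} (h : U ≤ V) (h' : V ≤ W) (x : PowerSeries Γ(X, W)) :
    PowerSeries.map (resO h) (PowerSeries.map (resO h') x) =
      PowerSeries.map (resO (h.trans h')) x := by
  ext n; simp [resO_resO]

lemma map_resO_self {U : X.Opens} (h : U ≤ U) (x : PowerSeries Γ(X, U)) :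
    PowerSeries.map (resO h) x = x := by
  ext n
  rw [PowerSeries.coeff_map]
  exact res_self (structureModule X) _ _

/-! ### Gluing -/

lemma res_ext (F : X.Modules) {κ : Type} (V : κ → X.Opens) (W : X.Opens) (hV : ∀ k, V k ≤ W)
    (hW : W ≤ iSup V) {s t : Γ(F, W)} (h : ∀ k, res F (hV k) s = res F (hV k) t) : s = t :=
  TopCat.Sheaf.eq_of_locally_eq' (⟨F.presheaf, F.isSheaf⟩ : TopCat.Sheaf Ab X) V W
    (fun k ↦ homOfLE (hV k)) hW s t h

lemma res_glue (F : X.Modules) {κ : Type} (V : κ → X.Opens) (W : X.Opens) (hV : ∀ k, V k ≤ W)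
    (hW : W ≤ iSup V) (sf : ∀ k, Γ(F, V k))
    (h : ∀ k l, res F (inf_le_left : V k ⊓ V l ≤ V k) (sf k) =
      res F (inf_le_right : V k ⊓ V l ≤ V l) (sf l)) :
    ∃ s : Γ(F, W), ∀ k, res F (hV k) s = sf k :=
  (TopCat.Sheaf.existsUnique_gluing' (⟨F.presheaf, F.isSheaf⟩ : TopCat.Sheaf Ab X) V W
    (fun k ↦ homOfLE (hV k)) hW sf h).exists

/-! ### The formal scheme `X × Spf ℂ[[t]]` -/

/-- The presheaf of rings `W ↦ 𝒪_X(W)[[t]]`. -/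
def formalStructurePresheaf (X : Scheme.{0}) : TopCat.Presheaf RingCat.{0} X where
  obj W := RingCat.of (PowerSeries Γ(X, W.unop))
  map h := RingCat.ofHom (PowerSeries.map (resO h.unop.le))
  map_id W := by
    refine RingCat.hom_ext (RingHom.ext fun f ↦ ?_)
    exact map_resO_self (𝟙 W : W ⟶ W).unop.le f
  map_comp h h' := by
    refine RingCat.hom_ext (RingHom.ext fun f ↦ ?_)
    exact (map_resO_resO h'.unop.le h.unop.le f).symm

lemma formalStructurePresheaf_isSheaf (X : Scheme.{0}) :
    (formalStructurePresheaf X).IsSheaf := by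
  rw [TopCat.Presheaf.isSheaf_iff_isSheafUniqueGluing]
  intro κ V sf hsf
  let sf' : ∀ k, PowerSeries Γ(X, V k) := sf
  have hsf' : ∀ k l, PowerSeries.map (resO (inf_le_left : V k ⊓ V l ≤ V k)) (sf' k) =
    PowerSeries.map (resO (inf_le_right : V k ⊓ V l ≤ V l)) (sf' l) := hsf
  have hg : ∀ n, ∃ s : Γ(X, iSup V), ∀ k, resO (le_iSup V k) s = PowerSeries.coeff n (sf' k) := by
    intro n
    refine res_glue (structureModule X) V (iSup V) (le_iSup V) le_rfl
      (fun k ↦ (PowerSeries.coeff n (sf' k) : Γ(X, V k))) fun k l ↦ ?_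
    have := congrArg (PowerSeries.coeff n) (hsf' k l)
    rw [PowerSeries.coeff_map, PowerSeries.coeff_map] at this
    exact this
  choose g hg using hg
  refine ⟨(PowerSeries.mk g : PowerSeries Γ(X, iSup V)), fun k ↦ ?_, fun y hy ↦ ?_⟩
  · change PowerSeries.map (resO (le_iSup V k)) (PowerSeries.mk g) = sf' k
    ext n
    rw [PowerSeries.coeff_map, PowerSeries.coeff_mk, hg]
  · let y' : PowerSeries Γ(X, iSup V) := y
    have hy' : ∀ k, PowerSeries.map (resO (le_iSup V k)) y' = sf' k := hy
    change y' = PowerSeries.mk g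
    ext n
    rw [PowerSeries.coeff_mk]
    refine res_ext (structureModule X) V (iSup V) (le_iSup V) le_rfl fun k ↦ ?_
    refine Eq.trans ?_ (hg n k).symm
    rw [← hy' k, PowerSeries.coeff_map]; rfl

/-- The structure sheaf `𝒪_X[[t]]` of the formal scheme `X × Spf ℂ[[t]]`, whose underlying
topological space is `X`. -/
def formalStructureSheaf (X : Scheme.{0}) : TopCat.Sheaf RingCat.{0} X :=
  ⟨formalStructurePresheaf X, formalStructurePresheaf_isSheaf X⟩

/-- A sheaf of modules on `X × Spf ℂ[[t]]`. -/
abbrev FormalModules (X : Scheme.{0}) := SheafOfModules.{0} (formalStructureSheaf X)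

/-- Sections over `W` of a sheaf of modules on `X × Spf ℂ[[t]]`. -/
abbrev FormalModules.sec (M : FormalModules X) (W : X.Opens) : Type := M.val.obj (op W)

instance (M : FormalModules X) (W : X.Opens) : Module (PowerSeries Γ(X, W)) (M.sec W) :=
  inferInstanceAs (Module ((formalStructureSheaf X).obj.obj (op W)) (M.val.obj (op W)))

/-- Restriction of sections of a sheaf of modules on `X × Spf ℂ[[t]]`. -/
def FormalModules.restrict (M : FormalModules X) {V W : X.Opens} (h : V ≤ W) :
    M.sec W → M.sec V :=
  fun x ↦ M.val.map (homOfLE h).op x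

/-- A formal deformation of the line bundle `L` over `ℂ[[t]]`: a line bundle on
`X × Spf ℂ[[t]]`, with an identification of its restriction to `t = 0` with `L`, the latter being
given as a surjective morphism of sheaves `specialize` to `L` with kernel generated by `t`. -/
structure FormalDeformation (L : X.Modules) where
  bundle : FormalModules X
  isInvertible : IsInvertible bundle
  specialize : ∀ W : X.Opens, bundle.sec W →+ Γ(L, W)
  specialize_restrict : ∀ {V W : X.Opens} (h : V ≤ W) (x : bundle.sec W),
    specialize V (bundle.restrict h x) = res L h (specialize W x)
  specialize_smul : ∀ (W : X.Opens) (f : PowerSeries Γ(X, W)) (x : bundle.sec W),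
    specialize W (f • x) = PowerSeries.constantCoeff f • specialize W x
  specialize_eq_zero : ∀ (W : X.Opens) (x : bundle.sec W),
    specialize W x = 0 ↔ ∃ y : bundle.sec W, x = (PowerSeries.X : PowerSeries Γ(X, W)) • y
  specialize_surjective : ∀ (W : X.Opens) (y : Γ(L, W)), ∀ p ∈ W,
    ∃ (V : X.Opens) (h : V ≤ W) (x : bundle.sec V), p ∈ V ∧ specialize V x = res L h y

/-- A formal deformation of the pair `(s, L)` over `ℂ[[t]]`: a formal deformation of `L` and a
global section of it which restricts to `s` at `t = 0`. -/
structure FormalPairDeformation (L : X.Modules) (s : Γ(L, ⊤)) extends FormalDeformation L where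
  sect : bundle.sec ⊤
  specialize_sect : specialize ⊤ sect = s

/-! ### The straight line deformation -/

/-- The constant functions `ℂ → 𝒪_X(W)`. -/
def constants (f : X ⟶ Spec (.of ℂ)) (W : X.Opens) : ℂ →+* Γ(X, W) :=
  (resO le_top).comp (((Scheme.ΓSpecIso (.of ℂ)).inv ≫ f.appTop).hom)

/-- The power series `exp(t b) = ∑ bⁿ tⁿ / n!`. -/
def expT (f : X ⟶ Spec (.of ℂ)) {W : X.Opens} (b : Γ(X, W)) : PowerSeries Γ(X, W) :=
  PowerSeries.mk fun n ↦ constants f W (1 / (n.factorial : ℂ)) * b ^ n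

lemma resO_constants (f : X ⟶ Spec (.of ℂ)) {V W : X.Opens} (h : V ≤ W) (z : ℂ) :
    resO h (constants f W z) = constants f V z := by
  simp only [constants, RingHom.comp_apply]
  exact resO_resO _ _ _

lemma map_expT (f : X ⟶ Spec (.of ℂ)) {V W : X.Opens} (h : V ≤ W) (b : Γ(X, W)) :
    PowerSeries.map (resO h) (expT f b) = expT f (resO h b) := by
  ext n
  simp only [expT, PowerSeries.coeff_map, PowerSeries.coeff_mk, map_mul, map_pow, resO_constants]

lemma expT_add (f : X ⟶ Spec (.of ℂ)) {W : X.Opens} (b b' : Γ(X, W)) :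
    expT f (b + b') = expT f b * expT f b' := by
  let _ : Algebra ℚ Γ(X, W) := ((constants f W).comp (algebraMap ℚ ℂ)).toAlgebra
  have key : ∀ c : Γ(X, W), expT f c = PowerSeries.rescale c (PowerSeries.exp Γ(X, W)) := by
    intro c
    ext n
    rw [expT, PowerSeries.coeff_mk, PowerSeries.coeff_rescale, PowerSeries.coeff_exp, mul_comm]
    congr 1
    change _ = constants f W (algebraMap ℚ ℂ _)
    simp
  rw [key, key, key, PowerSeries.exp_mul_exp_eq_exp_add]

lemma expT_zero (f : X ⟶ Spec (.of ℂ)) (W : X.Opens) : expT f (0 : Γ(X, W)) = 1 := by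
  ext n
  rw [expT, PowerSeries.coeff_mk, PowerSeries.coeff_one]
  rcases n with _ | n <;> simp

lemma constantCoeff_expT (f : X ⟶ Spec (.of ℂ)) {W : X.Opens} (b : Γ(X, W)) :
    PowerSeries.constantCoeff (expT f b) = 1 := by
  rw [← PowerSeries.coeff_zero_eq_constantCoeff_apply, expT, PowerSeries.coeff_mk]
  simp

lemma X_smul_zero {A M : Type} [CommRing A] [AddCommGroup M] [Module A M] (m : Formal M) :
    ((PowerSeries.X : PowerSeries A) • m) 0 = 0 := by
  rw [formal_smul_apply]; simp

lemma X_smul_succ {A M : Type} [CommRing A] [AddCommGroup M] [Module A M] (m : Formal M) (n : ℕ) :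
    ((PowerSeries.X : PowerSeries A) • m) (n + 1) = m n := by
  rw [formal_smul_apply, Finset.Nat.sum_antidiagonal_eq_sum_range_succ_mk,
    Finset.sum_eq_single 1]
  · simp
  · intro b _ hb; simp [PowerSeries.coeff_X, hb]
  · simp

lemma smul_apply_zero {A M : Type} [CommRing A] [AddCommGroup M] [Module A M]
    (f : PowerSeries A) (m : Formal M) : (f • m) 0 = PowerSeries.constantCoeff f • m 0 := by
  rw [formal_smul_apply]; simp

/-- The constant power series with value `m`. -/
def Formal.const {M : Type} [AddCommGroup M] (m : M) : Formal M := fun n ↦ if n = 0 then m else 0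

lemma smul_const_apply {A M : Type} [CommRing A] [AddCommGroup M] [Module A M]
    (f : PowerSeries A) (m : M) (n : ℕ) :
    (f • Formal.const m) n = PowerSeries.coeff n f • m := by
  rw [formal_smul_apply, Finset.Nat.sum_antidiagonal_eq_sum_range_succ_mk,
    Finset.sum_eq_single n]
  · simp [Formal.const]
  · intro b hb hb'
    have : n - b ≠ 0 := by have := Finset.mem_range.1 hb; lia
    simp [Formal.const, this]
  · simp

lemma resF_const (F : X.Modules) {V W : X.Opens} (h : V ≤ W) (m : Γ(F, W)) :
    resF F h (Formal.const m) = Formal.const (res F h m) := by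
  funext n
  change res F h (if n = 0 then m else 0) = if n = 0 then _ else 0
  split_ifs
  · rfl
  · exact map_zero _

/-- `exp(t a(i, j))` on an open contained in `U i` and `U j`. -/
def transition (f : X ⟶ Spec (.of ℂ)) (a : cocycles U (structureModule X) 1) (i j : ι)
    (W : X.Opens) (hi : W ≤ U i) (hj : W ≤ U j) : PowerSeries Γ(X, W) :=
  expT f (toFun (Cochain.ev a.1 ![i, j] W (pair_le hi hj)))

lemma map_transition (f : X ⟶ Spec (.of ℂ)) (a : cocycles U (structureModule X) 1) (i j : ι)
    {V W : X.Opens} (h : V ≤ W) (hi : W ≤ U i) (hj : W ≤ U j) :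
    PowerSeries.map (resO h) (transition f a i j W hi hj) =
      transition f a i j V (h.trans hi) (h.trans hj) := by
  rw [transition, map_expT, ← toFun_res, res_ev]; rfl

lemma transition_mul (f : X ⟶ Spec (.of ℂ)) (a : cocycles U (structureModule X) 1) (i j l : ι)
    (W : X.Opens) (hi : W ≤ U i) (hj : W ≤ U j) (hl : W ≤ U l) :
    transition f a i l W hi hl = transition f a i j W hi hj * transition f a j l W hj hl := by
  rw [transition, cocycle_add a.2 i j l W hi hj hl, toFun_add, expT_add]; rfl

lemma transition_self (f : X ⟶ Spec (.of ℂ)) (a : cocycles U (structureModule X) 1) (i : ι)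
    (W : X.Opens) (hi : W ≤ U i) : transition f a i i W hi hi = 1 := by
  have h := cocycle_add a.2 i i i W hi hi hi
  rw [left_eq_add] at h
  rw [transition, h]
  exact expT_zero f W

/-- The sections over `W` of `L ⊗ exp(t v)`, where `v` is the class of the cocycle `a`: families of
sections `S i` of `L[[t]]` over `W ∩ U i` such that `S i = exp(t a(i, j)) S j`. -/
def twist (f : X ⟶ Spec (.of ℂ)) (a : cocycles U (structureModule X) 1) (L : X.Modules)
    (W : X.Opens) : AddSubgroup (∀ i, Formal Γ(L, W ⊓ U i)) where
  carrier := {S | ∀ i j,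
    resF L (inf_le_inf_left W inf_le_left : W ⊓ (U i ⊓ U j) ≤ W ⊓ U i) (S i) =
      transition f a i j (W ⊓ (U i ⊓ U j)) (inf_le_right.trans inf_le_left)
          (inf_le_right.trans inf_le_right) •
        resF L (inf_le_inf_left W inf_le_right : W ⊓ (U i ⊓ U j) ≤ W ⊓ U j) (S j)}
  zero_mem' i j := by simp
  add_mem' {S T} hS hT i j := by
    simp only [Pi.add_apply, map_add, smul_add, hS i j, hT i j]
  neg_mem' {S} hS i j := by
    simp only [Pi.neg_apply, map_neg, smul_neg, hS i j]

section Twist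

variable (f : X ⟶ Spec (.of ℂ)) (a : cocycles U (structureModule X) 1) (L : X.Modules)

instance (W : X.Opens) : SMul (PowerSeries Γ(X, W)) (twist f a L W) where
  smul r S := ⟨fun i ↦ PowerSeries.map (resO inf_le_left) r • S.1 i, fun i j ↦ by
    rw [resF_smul, resF_smul, map_resO_resO, map_resO_resO, S.2 i j, smul_comm]⟩

lemma twist_smul_apply {W : X.Opens} (r : PowerSeries Γ(X, W)) (S : twist f a L W) (i : ι) :
    (r • S).1 i = PowerSeries.map (resO (inf_le_left : W ⊓ U i ≤ W)) r • S.1 i := rfl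

instance (W : X.Opens) : Module (PowerSeries Γ(X, W)) (twist f a L W) where
  one_smul S := by
    refine Subtype.ext (funext fun i ↦ ?_)
    rw [twist_smul_apply, map_one, one_smul]
  mul_smul r r' S := by
    refine Subtype.ext (funext fun i ↦ ?_)
    rw [twist_smul_apply, map_mul, mul_smul]; rfl
  smul_zero r := by
    refine Subtype.ext (funext fun i ↦ ?_)
    exact smul_zero _
  smul_add r S T := by
    refine Subtype.ext (funext fun i ↦ ?_)
    exact smul_add _ _ _
  add_smul r r' S := by
    refine Subtype.ext (funext fun i ↦ ?_)
    rw [twist_smul_apply, map_add, add_smul]; rfl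
  zero_smul S := by
    refine Subtype.ext (funext fun i ↦ ?_)
    rw [twist_smul_apply, map_zero, zero_smul]; rfl

/-- Restriction of sections of `L ⊗ exp(t v)`. -/
def twistRes {V W : X.Opens} (h : V ≤ W) : twist f a L W →+ twist f a L V where
  toFun S := ⟨fun i ↦ resF L (inf_le_inf_right (U i) h) (S.1 i), fun i j ↦ by
    have := congrArg (resF L (inf_le_inf_right (U i ⊓ U j) h)) (S.2 i j)
    rw [resF_smul, map_transition] at this
    simp only [resF_resF] at this ⊢
    exact this⟩
  map_zero' := Subtype.ext (funext fun i ↦ map_zero _)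
  map_add' S T := Subtype.ext (funext fun i ↦ map_add _ _ _)

lemma twistRes_apply {V W : X.Opens} (h : V ≤ W) (S : twist f a L W) (i : ι) :
    (twistRes f a L h S).1 i = resF L (inf_le_inf_right (U i) h) (S.1 i) := rfl

/-- The relation between the components of a section of `L ⊗ exp(t v)`, on any open. -/
lemma twist_rel {W : X.Opens} (S : twist f a L W) (i j : ι) (V : X.Opens) (hi : V ≤ W ⊓ U i)
    (hj : V ≤ W ⊓ U j) :
    resF L hi (S.1 i) = transition f a i j V (hi.trans inf_le_right) (hj.trans inf_le_right) •
      resF L hj (S.1 j) := by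
  have h : V ≤ W ⊓ (U i ⊓ U j) :=
    le_inf (hi.trans inf_le_left) (le_inf (hi.trans inf_le_right) (hj.trans inf_le_right))
  have := congrArg (resF L h) (S.2 i j)
  rw [resF_smul, map_transition] at this
  simp only [resF_resF] at this
  exact this

/-- The presheaf of abelian groups underlying `L ⊗ exp(t v)`. -/
def twistPresheaf : TopCat.Presheaf Ab.{0} X where
  obj W := AddCommGrpCat.of (twist f a L W.unop)
  map h := AddCommGrpCat.ofHom (twistRes f a L h.unop.le)
  map_id W := by
    refine AddCommGrpCat.hom_ext (AddMonoidHom.ext fun S ↦ Subtype.ext (funext fun i ↦ ?_))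
    exact resF_self _ _ _
  map_comp h h' := by
    refine AddCommGrpCat.hom_ext (AddMonoidHom.ext fun S ↦ Subtype.ext (funext fun i ↦ ?_))
    exact (resF_resF L _ _ _).symm

lemma le_iSup_inf {κ : Type} (V : κ → X.Opens) (W : X.Opens) :
    iSup V ⊓ W ≤ ⨆ k, V k ⊓ W := (iSup_inf_eq V W).le

lemma twistPresheaf_isSheaf : (twistPresheaf f a L).IsSheaf := by
  rw [TopCat.Presheaf.isSheaf_iff_isSheafUniqueGluing]
  intro κ V sf hsf
  let sf' : ∀ k, twist f a L (V k) := sf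
  have hsf' : ∀ k l, twistRes f a L (inf_le_left : V k ⊓ V l ≤ V k) (sf' k) =
    twistRes f a L (inf_le_right : V k ⊓ V l ≤ V l) (sf' l) := hsf
  have hV : ∀ k, V k ≤ iSup V := le_iSup V
  have hg : ∀ i n, ∃ s : Γ(L, iSup V ⊓ U i), ∀ k,
      res L (inf_le_inf_right (U i) (hV k)) s = (sf' k).1 i n := by
    intro i n
    refine res_glue L (fun k ↦ V k ⊓ U i) _ (fun k ↦ inf_le_inf_right (U i) (hV k))
      (le_iSup_inf V (U i)) (fun k ↦ (sf' k).1 i n) fun k l ↦ ?_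
    have h1 := congrFun (congrFun (congrArg Subtype.val (hsf' k l)) i) n
    have h2 := congrArg (res L (le_inf (le_inf (inf_le_left.trans inf_le_left)
      (inf_le_right.trans inf_le_left)) (inf_le_left.trans inf_le_right) :
      (V k ⊓ U i) ⊓ (V l ⊓ U i) ≤ (V k ⊓ V l) ⊓ U i)) h1
    refine (res_res L _ _ _).symm.trans (h2.trans (res_res L _ _ _))
  choose g' hg using hg
  let g : ∀ i, Formal Γ(L, iSup V ⊓ U i) := g'
  have hg' : ∀ i k, resF L (inf_le_inf_right (U i) (hV k)) (g i) = (sf' k).1 i :=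
    fun i k ↦ funext fun n ↦ hg i n k
  refine ⟨(⟨g, fun i j ↦ ?_⟩ : twist f a L (iSup V)), fun k ↦ ?_, fun y hy ↦ ?_⟩
  · funext n
    refine res_ext L (fun k ↦ V k ⊓ (U i ⊓ U j)) _
      (fun k ↦ inf_le_inf_right (U i ⊓ U j) (hV k)) (le_iSup_inf V _) fun k ↦ ?_
    refine congrFun (?_ : resF L (inf_le_inf_right (U i ⊓ U j) (hV k)) _ =
      resF L (inf_le_inf_right (U i ⊓ U j) (hV k)) _) n
    rw [resF_smul, map_transition, resF_resF, resF_resF]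
    have := (sf' k).2 i j
    rw [← hg' i k, ← hg' j k, resF_resF, resF_resF] at this
    exact this
  · exact Subtype.ext (funext fun i ↦ hg' i k)
  · let y' : twist f a L (iSup V) := y
    have hy' : ∀ k, twistRes f a L (hV k) y' = sf' k := hy
    refine (Subtype.ext (funext fun i ↦ funext fun n ↦ ?_) : y' = ⟨g, _⟩)
    refine res_ext L (fun k ↦ V k ⊓ U i) _ (fun k ↦ inf_le_inf_right (U i) (hV k))
      (le_iSup_inf V (U i)) fun k ↦ ?_
    refine Eq.trans ?_ (hg i n k).symm
    rw [← hy' k]; rfl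

instance (W : (TopologicalSpace.Opens X)ᵒᵖ) :
    Module ((formalStructureSheaf X).obj.obj W) ((twistPresheaf f a L).obj W) :=
  inferInstanceAs (Module (PowerSeries Γ(X, W.unop)) (twist f a L W.unop))

lemma twistRes_smul {V W : X.Opens} (h : V ≤ W) (r : PowerSeries Γ(X, W)) (S : twist f a L W) :
    twistRes f a L h (r • S) = PowerSeries.map (resO h) r • twistRes f a L h S := by
  refine Subtype.ext (funext fun i ↦ ?_)
  rw [twist_smul_apply, twistRes_apply, twist_smul_apply, resF_smul, map_resO_resO, map_resO_resO,
    twistRes_apply]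

/-- `L ⊗ exp(t v)` as a sheaf of modules on `X × Spf ℂ[[t]]`, where `v` is the class of `a`. -/
def twistModule : FormalModules X where
  val := PresheafOfModules.ofPresheaf (twistPresheaf f a L)
    fun _ _ h r S ↦ twistRes_smul f a L h.unop.le r S
  isSheaf := twistPresheaf_isSheaf f a L

/-- Over an open contained in `U i`, a section of `L[[t]]` defines one of `L ⊗ exp(t v)`. -/
def spread {V : X.Opens} (i : ι) (hV : V ≤ U i) (m : Formal Γ(L, V)) : twist f a L V :=
  ⟨fun k ↦ transition f a k i (V ⊓ U k) inf_le_right (inf_le_left.trans hV) •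
    resF L inf_le_left m, fun k l ↦ by
      rw [resF_smul, resF_smul, map_transition, map_transition, resF_resF, resF_resF, ← mul_smul,
        ← transition_mul]⟩

lemma spread_self {V : X.Opens} (i : ι) (hV : V ≤ U i) (S : twist f a L V) :
    spread f a L i hV (resF L (le_inf le_rfl hV) (S.1 i)) = S := by
  refine Subtype.ext (funext fun k ↦ ?_)
  change transition f a k i (V ⊓ U k) _ _ • resF L inf_le_left (resF L _ (S.1 i)) = _
  rw [resF_resF, ← twist_rel f a L S k i (V ⊓ U k) le_rfl (le_inf inf_le_left
    (inf_le_left.trans hV)), resF_self]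

lemma spread_apply_self {V : X.Opens} (i : ι) (hV : V ≤ U i) (m : Formal Γ(L, V)) :
    resF L (le_inf le_rfl hV) ((spread f a L i hV m).1 i) = m := by
  change resF L _ (transition f a i i (V ⊓ U i) _ _ • resF L inf_le_left m) = m
  rw [transition_self, one_smul, resF_resF, resF_self]

lemma smul_spread {V : X.Opens} (i : ι) (hV : V ≤ U i) (r : PowerSeries Γ(X, V))
    (m : Formal Γ(L, V)) : r • spread f a L i hV m = spread f a L i hV (r • m) := by
  refine Subtype.ext (funext fun k ↦ ?_)
  change PowerSeries.map _ r • transition f a k i (V ⊓ U k) _ _ • resF L inf_le_left m =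
    transition f a k i (V ⊓ U k) _ _ • resF L inf_le_left (r • m)
  rw [resF_smul, smul_comm]

lemma twistRes_spread {V W : X.Opens} (h : V ≤ W) (i : ι) (hW : W ≤ U i) (m : Formal Γ(L, W)) :
    twistRes f a L h (spread f a L i hW m) = spread f a L i (h.trans hW) (resF L h m) := by
  refine Subtype.ext (funext fun k ↦ ?_)
  change resF L _ (transition f a k i (W ⊓ U k) _ _ • resF L inf_le_left m) =
    transition f a k i (V ⊓ U k) _ _ • resF L inf_le_left (resF L h m)
  rw [resF_smul, map_transition, resF_resF, resF_resF]

lemma exists_mem_cover (hU : ⨆ i, U i = ⊤) (x : X) : ∃ i, x ∈ U i :=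
  TopologicalSpace.Opens.mem_iSup.1 (hU ▸ trivial : x ∈ ⨆ i, U i)

lemma twistModule_isInvertible (hU : ⨆ i, U i = ⊤) (hL : IsLineBundle L) :
    IsInvertible (twistModule f a L) := by
  intro x
  obtain ⟨i, hi⟩ := exists_mem_cover hU x
  obtain ⟨W, hW, e, he⟩ := hL x
  let e' : Γ(L, W) := e
  have he' : ∀ (V : X.Opens) (h : V ≤ W),
    Function.Bijective fun r : Γ(X, V) ↦ r • res L h e' := he
  refine ⟨W ⊓ U i, ⟨hW, hi⟩,
    spread f a L i inf_le_right (Formal.const (res L inf_le_left e')), fun V h ↦ ?_⟩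
  have key : ∀ r : PowerSeries Γ(X, V), r • twistRes f a L h
      (spread f a L i inf_le_right (Formal.const (res L inf_le_left e'))) =
      spread f a L i (h.trans inf_le_right)
        (r • Formal.const (res L (h.trans inf_le_left) e')) := by
    intro r
    rw [twistRes_spread, smul_spread, resF_const, res_res]
  refine (?_ : Function.Bijective fun r : PowerSeries Γ(X, V) ↦ r • twistRes f a L h
      (spread f a L i inf_le_right (Formal.const (res L inf_le_left e'))))
  simp only [key]
  constructor
  · intro r r' hr
    have h1 := congrArg (fun S : twist f a L V ↦
      resF L (le_inf le_rfl (h.trans inf_le_right)) (S.1 i)) hr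
    simp only [spread_apply_self] at h1
    refine PowerSeries.ext fun n ↦ (he' V (h.trans inf_le_left)).1 ?_
    have h2 := congrFun h1 n
    rw [smul_const_apply, smul_const_apply] at h2
    exact h2
  · intro S
    choose r hr using fun n ↦ (he' V (h.trans inf_le_left)).2
      (resF L (le_inf le_rfl (h.trans inf_le_right)) (S.1 i) n)
    refine ⟨PowerSeries.mk r, ?_⟩
    rw [← spread_self f a L i (h.trans inf_le_right) S]
    refine congrArg (spread f a L i (h.trans inf_le_right)) (funext fun n ↦ ?_)
    rw [smul_const_apply, PowerSeries.coeff_mk]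
    exact hr n

lemma exists_specialize (hU : ⨆ i, U i = ⊤) {W : X.Opens} (S : twist f a L W) :
    ∃ y : Γ(L, W), ∀ i, res L (inf_le_left : W ⊓ U i ≤ W) y = S.1 i 0 := by
  refine res_glue L (fun i ↦ W ⊓ U i) W (fun i ↦ inf_le_left)
    (by rw [← inf_iSup_eq, hU, inf_top_eq]) (fun i ↦ S.1 i 0) fun i j ↦ ?_
  have := congrFun (twist_rel f a L S i j ((W ⊓ U i) ⊓ (W ⊓ U j)) inf_le_left inf_le_right) 0
  rw [smul_apply_zero, transition, constantCoeff_expT, one_smul] at this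
  exact this

lemma eq_of_cover (hU : ⨆ i, U i = ⊤) {W : X.Opens} {y y' : Γ(L, W)}
    (h : ∀ i, res L (inf_le_left : W ⊓ U i ≤ W) y = res L inf_le_left y') : y = y' :=
  res_ext L (fun i ↦ W ⊓ U i) W (fun _ ↦ inf_le_left)
    (by rw [← inf_iSup_eq, hU, inf_top_eq]) h

/-- The restriction to `t = 0` of a section of `L ⊗ exp(t v)`: the section of `L` which on
`W ∩ U i` is the constant term of the `i`-th component. -/
def twistSpecialize (hU : ⨆ i, U i = ⊤) (W : X.Opens) : twist f a L W →+ Γ(L, W) :=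
  AddMonoidHom.mk' (fun S ↦ (exists_specialize f a L hU S).choose) fun S T ↦ by
    refine eq_of_cover L hU fun i ↦ ?_
    rw [map_add, (exists_specialize f a L hU (S + T)).choose_spec i,
      (exists_specialize f a L hU S).choose_spec i, (exists_specialize f a L hU T).choose_spec i]
    rfl

lemma res_twistSpecialize (hU : ⨆ i, U i = ⊤) {W : X.Opens} (S : twist f a L W) (i : ι) :
    res L (inf_le_left : W ⊓ U i ≤ W) (twistSpecialize f a L hU W S) = S.1 i 0 :=
  (exists_specialize f a L hU S).choose_spec i

lemma twistSpecialize_restrict (hU : ⨆ i, U i = ⊤) {V W : X.Opens} (h : V ≤ W)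
    (S : twist f a L W) :
    twistSpecialize f a L hU V (twistRes f a L h S) =
      res L h (twistSpecialize f a L hU W S) := by
  refine eq_of_cover L hU fun i ↦ ?_
  rw [res_twistSpecialize, res_res, ← res_res L (inf_le_inf_right (U i) h) inf_le_left,
    res_twistSpecialize]
  rfl

lemma twistSpecialize_smul (hU : ⨆ i, U i = ⊤) (W : X.Opens) (r : PowerSeries Γ(X, W))
    (S : twist f a L W) :
    twistSpecialize f a L hU W (r • S) =
      PowerSeries.constantCoeff r • twistSpecialize f a L hU W S := by
  refine eq_of_cover L hU fun i ↦ ?_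
  rw [res_smul, res_twistSpecialize, res_twistSpecialize, twist_smul_apply, smul_apply_zero]
  refine congrArg (fun z : Γ(X, W ⊓ U i) ↦ z • S.1 i 0) ?_
  rw [← PowerSeries.coeff_zero_eq_constantCoeff_apply, PowerSeries.coeff_map,
    PowerSeries.coeff_zero_eq_constantCoeff_apply]

lemma twistSpecialize_eq_zero (hU : ⨆ i, U i = ⊤) (W : X.Opens) (S : twist f a L W) :
    twistSpecialize f a L hU W S = 0 ↔
      ∃ y : twist f a L W, S = (PowerSeries.X : PowerSeries Γ(X, W)) • y := by
  constructor
  · intro h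
    have h0 : ∀ i, S.1 i 0 = 0 := fun i ↦ by
      rw [← res_twistSpecialize f a L hU S i, h, map_zero]
    let y : ∀ i, Formal Γ(L, W ⊓ U i) := fun i n ↦ S.1 i (n + 1)
    have h1 : ∀ i, S.1 i = (PowerSeries.X : PowerSeries Γ(X, W ⊓ U i)) • y i := by
      intro i
      funext n
      cases n with
      | zero => rw [X_smul_zero, h0]
      | succ n => rw [X_smul_succ]
    refine ⟨⟨y, fun i j ↦ ?_⟩, Subtype.ext (funext fun i ↦ ?_)⟩
    · have h2 := S.2 i j
      rw [h1 i, h1 j, resF_smul, resF_smul, PowerSeries.map_X, PowerSeries.map_X,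
        smul_comm] at h2
      funext n
      have h3 := congrFun h2 (n + 1)
      rw [X_smul_succ, X_smul_succ] at h3
      exact h3
    · rw [twist_smul_apply, PowerSeries.map_X]
      exact h1 i
  · rintro ⟨y, rfl⟩
    refine eq_of_cover L hU fun i ↦ ?_
    rw [res_twistSpecialize, twist_smul_apply, PowerSeries.map_X, X_smul_zero, map_zero]

lemma twistSpecialize_surjective (hU : ⨆ i, U i = ⊤) (W : X.Opens) (y : Γ(L, W)) (p : X)
    (hp : p ∈ W) :
    ∃ (V : X.Opens) (h : V ≤ W) (S : twist f a L V),
      p ∈ V ∧ twistSpecialize f a L hU V S = res L h y := by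
  obtain ⟨i, hi⟩ := exists_mem_cover hU p
  refine ⟨W ⊓ U i, inf_le_left,
    spread f a L i inf_le_right (Formal.const (res L inf_le_left y)), ⟨hp, hi⟩, ?_⟩
  refine eq_of_cover L hU fun k ↦ ?_
  rw [res_twistSpecialize]
  change (transition f a k i _ _ _ • resF L inf_le_left (Formal.const _)) 0 = _
  rw [smul_apply_zero, transition, constantCoeff_expT, one_smul]
  rfl

/-- The formal straight line deformation `L_v(t) = L ⊗ exp(t v)` of the line bundle `L` in the
direction `v`, where the class `v ∈ H¹(𝒪_X)` is represented by the cocycle `a` on the open cover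
`U`: it is glued from the `L[[t]]` on the `U i` by the transition functions `exp(t a(i, j))`. -/
def straightLine (hU : ⨆ i, U i = ⊤) (hL : IsLineBundle L) : FormalDeformation L where
  bundle := twistModule f a L
  isInvertible := twistModule_isInvertible f a L hU hL
  specialize := twistSpecialize f a L hU
  specialize_restrict h S := twistSpecialize_restrict f a L hU h S
  specialize_smul W r S := twistSpecialize_smul f a L hU W r S
  specialize_eq_zero W S := twistSpecialize_eq_zero f a L hU W S
  specialize_surjective W y p hp := twistSpecialize_surjective f a L hU W y p hp

end Twist

end FormalLift

end

open FormalLift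

/-! Trivialize `L ⊗ exp(t v)` over the first member of each tuple of the cover. Its Čech
differential then becomes a power series `d(t) = ∑ dₙ tⁿ` acting on cochains of `L` with
coefficients in formal power series: `d₀` is the Čech differential of `L`, and for `n ≥ 1` the
operator `dₙ` is the cup product with `aⁿ / n!`. In particular `d₁ = a ∪ ·`. Since `exp(t a(i, j))`
is multiplicative in `(i, j)`, `d(t)² = 0` (`twistedD_twistedD`). A section of `L ⊗ exp(t v)`
lifting `s` is a formal 0-cochain `S` with `d(t) S = 0` and `S₀ = s`.

Such an `S` is built order by order (`exists_formalMap_correction`). If `d(t) S` vanishes through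
order `n`, write `d(t) S = y tⁿ⁺¹ + y' tⁿ⁺² + ⋯`. The two lowest terms of `d(t)² S = 0` read `d₀ y =
0` and `d₁ y + d₀ y' = 0`, so the obstruction class of `y` in `H¹(L)` is killed by `v`. By
transversality `y = d₁ u + d₀ w` with `d₀ u = 0`, and subtracting `u tⁿ + w tⁿ⁺¹` from `S` removes
the obstruction without spoiling the lower orders.

The price is a change in order `n` itself. For `n = 0` this would alter `s`, so the induction has to
start from a first order lift, which is what `s ∪ v = 0` supplies. Afterwards each coefficient is
eventually constant, and the limit is the required `S` (`exists_formalMap_eq_zero`). -/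

noncomputable section

namespace FormalLift

open Finset

/-! ### Formal families of differentials and order-by-order lifting. -/

section FormalComplex

variable {A B C : Type} [AddCommGroup A] [AddCommGroup B] [AddCommGroup C]

/-- The action of the formal family of homomorphisms `∑ d n tⁿ` on `A[[t]]`. -/
def formalMap (d : ℕ → A →+ B) : (ℕ → A) →+ (ℕ → B) where
  toFun S n := ∑ p ∈ antidiagonal n, d p.1 (S p.2)
  map_zero' := by funext n; simp
  map_add' S T := by funext n; simp [Finset.sum_add_distrib]

lemma formalMap_apply (d : ℕ → A →+ B) (S : ℕ → A) (n : ℕ) :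
    formalMap d S n = ∑ p ∈ antidiagonal n, d p.1 (S p.2) := rfl

lemma formalMap_congr (d : ℕ → A →+ B) {S T : ℕ → A} {n : ℕ} (h : ∀ k ≤ n, S k = T k) :
    formalMap d S n = formalMap d T n := by
  rw [formalMap_apply, formalMap_apply]
  refine Finset.sum_congr rfl fun p hp ↦ ?_
  rw [h p.2 (by have := HasAntidiagonal.mem_antidiagonal.1 hp; lia)]

/-- Leading term: when `S` is divisible by `tⁿ`, only `d 0` can contribute in order `n`. -/
lemma formalMap_of_eq_zero (d : ℕ → A →+ B) {S : ℕ → A} {n : ℕ}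
    (h : ∀ k < n, S k = 0) : formalMap d S n = d 0 (S n) := by
  rw [formalMap_apply, Finset.sum_eq_single (0, n)]
  · rintro ⟨p, q⟩ hp hne
    rw [HasAntidiagonal.mem_antidiagonal] at hp
    have : q < n := by
      rcases Nat.eq_zero_or_pos p with rfl | h0
      · exact (hne (Prod.ext rfl ((zero_add q).symm.trans hp))).elim
      · lia
    rw [h q this, map_zero]
  · simp

lemma formalMap_succ_of_eq_zero (d : ℕ → A →+ B) {S : ℕ → A} {n : ℕ}
    (h : ∀ k < n, S k = 0) :
    formalMap d S (n + 1) = d 0 (S (n + 1)) + d 1 (S n) := by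
  rw [formalMap_apply, Nat.sum_antidiagonal_succ]
  congr 1
  -- What is left after splitting off `d 0` is order `n` of the shifted family, so its leading term
  -- is `d 1 (S n)`.
  exact formalMap_of_eq_zero (fun p ↦ d (p + 1)) h

/-- Composition multiplies the two families as power series in `t`. Regrouping the triple sum so
that the two operator indices are added first exposes the coefficients of `d'(t) d(t)`, which vanish
by `hd`. -/
lemma formalMap_formalMap (d : ℕ → A →+ B) (d' : ℕ → B →+ C)
    (hd : ∀ n x, ∑ p ∈ antidiagonal n, d' p.1 (d p.2 x) = 0) (S : ℕ → A) :
    formalMap d' (formalMap d S) = 0 := by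
  funext n
  have h : formalMap d' (formalMap d S) n =
      ∑ p ∈ antidiagonal n, ∑ q ∈ antidiagonal p.1, d' q.1 (d q.2 (S p.2)) := by
    simp only [formalMap_apply, map_sum]
    rw [Finset.sum_sigma', Finset.sum_sigma']
    refine Finset.sum_nbij' (fun ⟨⟨i, _⟩, ⟨k, l⟩⟩ ↦ ⟨(i + k, l), (i, k)⟩)
      (fun ⟨⟨_, j⟩, ⟨k, l⟩⟩ ↦ ⟨(k, l + j), (l, j)⟩) ?_ ?_ ?_ ?_ ?_ <;>
      simp +contextual [add_assoc]
    all_goals intros; lia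
  rw [h]
  exact Finset.sum_eq_zero fun p _ ↦ hd _ _

variable {d : ℕ → A →+ B} {d' : ℕ → B →+ C}

/-- If the first order part of a formal differential is exact on cohomology in degree one, a
cochain which is closed up to order `n` can be corrected in orders `n` and `n + 1` so as to become
closed up to order `n + 1`. -/
lemma exists_formalMap_correction
    (hd : ∀ n x, ∑ p ∈ antidiagonal n, d' p.1 (d p.2 x) = 0)
    (hex : ∀ y, d' 0 y = 0 → (∃ z, d' 0 z = d' 1 y) → ∃ u w, d 0 u = 0 ∧ y = d 1 u + d 0 w)
    {n : ℕ} {S : ℕ → A} (hS : ∀ k ≤ n, formalMap d S k = 0) :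
    ∃ T : ℕ → A, (∀ k ≤ n + 1, formalMap d T k = 0) ∧ ∀ k < n, T k = S k := by
  have hlow : ∀ k < n + 1, formalMap d S k = 0 := fun k hk ↦ hS k (by lia)
  have hdd := formalMap_formalMap d d' hd S
  -- The series `d(t) S` starts in order `n + 1`; the leading and next-to-leading terms of `d'(t)
  -- d(t) S = 0` are `h0` and `h1`.
  have h0 : d' 0 (formalMap d S (n + 1)) = 0 := by
    rw [← formalMap_of_eq_zero d' hlow, hdd]; rfl
  have h1 : d' 0 (- formalMap d S (n + 1 + 1)) = d' 1 (formalMap d S (n + 1)) := by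
    have := formalMap_succ_of_eq_zero d' hlow
    rw [hdd, Pi.zero_apply] at this
    rw [map_neg, neg_eq_iff_add_eq_zero, ← this]
  obtain ⟨u, w, hu, huw⟩ := hex _ h0 ⟨_, h1⟩
  -- The correction `u tⁿ + w tⁿ⁺¹`: it contributes `d₀ u = 0` in order `n`, and `d₀ w + d₁ u`, the
  -- whole obstruction, in order `n + 1`.
  let R : ℕ → A := fun k ↦ if k = n then u else if k = n + 1 then w else 0
  have hR : ∀ k < n, R k = 0 := fun k hk ↦ by
    simp only [R, if_neg hk.ne, if_neg (by lia : k ≠ n + 1)]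
  have hRn : R n = u := if_pos rfl
  have hRn' : R (n + 1) = w := by simp [R]
  refine ⟨S - R, fun k hk ↦ ?_, fun k hk ↦ by rw [Pi.sub_apply, hR k hk, sub_zero]⟩
  rw [map_sub, Pi.sub_apply]
  rcases lt_trichotomy k n with hkn | rfl | hkn
  · rw [hS k hkn.le, formalMap_of_eq_zero d fun j hj ↦ hR j (hj.trans hkn), hR k hkn,
      map_zero, sub_zero]
  · rw [hS k le_rfl, formalMap_of_eq_zero d hR, hRn, hu, sub_zero]
  · obtain rfl : k = n + 1 := by lia
    rw [formalMap_succ_of_eq_zero d hR, hRn, hRn', huw, add_comm (d 0 w), sub_self]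

/-- A cocycle of the special fibre which lifts to first order lifts to all orders, if the first
order part of the formal differential is exact on cohomology in the next degree. -/
lemma exists_formalMap_eq_zero
    (hd : ∀ n x, ∑ p ∈ antidiagonal n, d' p.1 (d p.2 x) = 0)
    (hex : ∀ y, d' 0 y = 0 → (∃ z, d' 0 z = d' 1 y) → ∃ u w, d 0 u = 0 ∧ y = d 1 u + d 0 w)
    {s : A} (hs : d 0 s = 0) (hs' : ∃ z, d 0 z = d 1 s) :
    ∃ S : ℕ → A, S 0 = s ∧ formalMap d S = 0 := by
  obtain ⟨z, hz⟩ := hs'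
  -- The sign gives `d₁ s + d₀ (-z) = 0` in order one. The coefficients beyond order one are
  -- arbitrary, since nothing is claimed there.
  let S₁ : ℕ → A := fun k ↦ if k = 0 then s else - z
  have hS₁ : ∀ k ≤ 0 + 1, formalMap d S₁ k = 0 := by
    intro k hk
    rcases Nat.le_one_iff_eq_zero_or_eq_one.1 hk with rfl | rfl
    · rw [formalMap_of_eq_zero d (by simp)]
      exact hs
    · rw [← zero_add 1, formalMap_succ_of_eq_zero d (by simp)]
      simp [S₁, hz]
  choose next hnext hnext' using fun (n : ℕ) (S : {S : ℕ → A // ∀ k ≤ n, formalMap d S k = 0}) ↦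
    exists_formalMap_correction hd hex S.2
  -- The stage `T n` is closed through order `n + 1`, one order ahead of its index. The next
  -- correction therefore touches only orders above `n`, and coefficient `k` is frozen from `T k`
  -- on; in particular `s` is never changed.
  let T : ∀ n : ℕ, {S : ℕ → A // ∀ k ≤ n + 1, formalMap d S k = 0} := fun n ↦
    Nat.rec ⟨S₁, hS₁⟩ (fun m S ↦ ⟨next (m + 1) S, hnext (m + 1) S⟩) n
  have hT : ∀ n k, k ≤ n → (T (n + 1)).1 k = (T n).1 k := fun n k hk ↦
    hnext' (n + 1) (T n) k (by lia)
  have hT' : ∀ n k, k ≤ n → (T n).1 k = (T k).1 k := fun n k hk ↦ by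
    induction n, hk using Nat.le_induction with
    | base => rfl
    | succ m hm ih => rw [hT m k hm, ih]
  refine ⟨fun k ↦ (T k).1 k, rfl, funext fun n ↦ ?_⟩
  -- Order `n` sees only the coefficients up to `n`, where the diagonal sequence agrees with `T n`.
  rw [formalMap_congr d (T := (T n).1) fun k hk ↦ (hT' n k hk).symm]
  exact (T n).2 n (by lia)

end FormalComplex

/-! ### The Čech differential of the straight line deformation, expanded in powers of `t`. -/

section TwistedDifferential

variable {X : Scheme.{0}} {ι : Type} {U : ι → X.Opens}

/-- The cochain `aⁿ / n!`, the coefficient of `tⁿ` in `exp(t a)`. -/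
def expCoeff (f : X ⟶ Spec (.of ℂ)) (a : cocycles U (structureModule X) 1) (n : ℕ) :
    Cochain U (structureModule X) 1 :=
  fun i ↦ (PowerSeries.coeff n (expT f (toFun (a.1 i))) : Γ(X, ⨅ j, U (i j)))

variable (f : X ⟶ Spec (.of ℂ)) (a : cocycles U (structureModule X) 1) (L : X.Modules)

lemma ev_expCoeff (n : ℕ) (i j : ι) (W : X.Opens) (hi : W ≤ U i) (hj : W ≤ U j) :
    toFun ((expCoeff f a n).ev ![i, j] W (pair_le hi hj)) =
      PowerSeries.coeff n (transition f a i j W hi hj) := by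
  have h : W ≤ ⨅ m, U (![i, j] m) := le_iInf (pair_le hi hj)
  change resO h (PowerSeries.coeff n (expT f (toFun (a.1 ![i, j])))) = _
  rw [← PowerSeries.coeff_map, map_expT]
  rfl

lemma expCoeff_one : expCoeff f a 1 = a.1 := by
  funext i
  change PowerSeries.coeff 1 (expT f (toFun (a.1 i))) = toFun (a.1 i)
  simp only [expT, PowerSeries.coeff_mk, Nat.factorial_one, Nat.cast_one, div_one, map_one, one_mul, pow_one]

/-- The coefficient of `tⁿ` of the Čech differential of `L ⊗ exp(t v)`, in terms of the
trivializations of `L ⊗ exp(t v)` over the first member of each tuple. -/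
def twistedD (k n : ℕ) : Cochain U L k →+ Cochain U L (k + 1) :=
  -- Only the face omitting the first index changes the trivialization, so it alone is multiplied by
  -- `exp(t a)`. The other faces occur in order zero only; they are the Čech differential minus that
  -- first face, which is the cup product with the constant cochain `1`.
  cup₁ (expCoeff f a n) + if n = 0 then cechD U L k - cup₁ (expCoeff f a 0) else 0

lemma twistedD_zero (k : ℕ) : twistedD f a L k 0 = cechD U L k := by
  simp [twistedD]

lemma twistedD_one (k : ℕ) : twistedD f a L k 1 = cup₁ a.1 := by
  simp [twistedD, expCoeff_one]

variable {L}

lemma ev_zero {k : ℕ} (i : Fin (k + 1) → ι) (W : X.Opens)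
    (h : ∀ j, W ≤ U (i j)) : Cochain.ev (0 : Cochain U L k) i W h = 0 :=
  map_zero (res L _)

lemma ev_sum {k : ℕ} {κ : Type} (t : Finset κ) (c : κ → Cochain U L k) (i : Fin (k + 1) → ι)
    (W : X.Opens) (h : ∀ j, W ≤ U (i j)) :
    Cochain.ev (∑ x ∈ t, c x) i W h = ∑ x ∈ t, (c x).ev i W h := by
  simp only [Cochain.ev, Finset.sum_apply, map_sum]

lemma triple_le {W : X.Opens} {i j l : ι} (hi : W ≤ U i) (hj : W ≤ U j) (hl : W ≤ U l)
    (m : Fin 3) : W ≤ U (![i, j, l] m) := by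
  fin_cases m <;> assumption

lemma coeff_zero_transition (i j : ι) (W : X.Opens) (hi : W ≤ U i) (hj : W ≤ U j) :
    PowerSeries.coeff 0 (transition f a i j W hi hj) = 1 := by
  rw [PowerSeries.coeff_zero_eq_constantCoeff_apply, transition, constantCoeff_expT]

/-- With `g = exp(t a)`, this is the coefficient of `tⁿ` in `g(i, j) c(j) - c(i)`, whose vanishing
is the gluing condition defining `twist`. -/
lemma ev_twistedD_zero (n : ℕ) (c : Cochain U L 0) (i j : ι) (W : X.Opens)
    (hi : W ≤ U i) (hj : W ≤ U j) :
    (twistedD f a L 0 n c).ev ![i, j] W (pair_le hi hj) =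
      PowerSeries.coeff n (transition f a i j W hi hj) • c.ev (fun _ ↦ j) W (fun _ ↦ hj) -
        if n = 0 then c.ev (fun _ ↦ i) W (fun _ ↦ hi) else 0 := by
  have hcup : ∀ m, (cup₁ (expCoeff f a m) c).ev ![i, j] W (pair_le hi hj) =
      PowerSeries.coeff m (transition f a i j W hi hj) • c.ev (fun _ ↦ j) W (fun _ ↦ hj) := by
    intro m
    rw [ev_cup₁]
    exact congrArg₂ (· • ·) (ev_expCoeff f a m i j W hi hj)
      (ev_congr c (by ext m; fin_cases m; rfl) W _ _)
  rcases eq_or_ne n 0 with rfl | hn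
  · rw [twistedD_zero, coeff_zero_transition, one_smul, if_pos rfl, ev_cechD, Fin.sum_univ_two]
    simp only [Fin.val_zero, pow_zero, one_smul, Fin.val_one, pow_one, neg_smul]
    rw [← sub_eq_add_neg]
    exact congrArg₂ (· - ·) (ev_congr c (by ext m; fin_cases m; rfl) W _ _)
      (ev_congr c (by ext m; fin_cases m; rfl) W _ _)
  · rw [twistedD, if_neg hn, if_neg hn, add_zero, sub_zero, hcup]

lemma ev_twistedD_one (n : ℕ) (c : Cochain U L 1) (i j l : ι) (W : X.Opens)
    (hi : W ≤ U i) (hj : W ≤ U j) (hl : W ≤ U l) :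
    (twistedD f a L 1 n c).ev ![i, j, l] W (triple_le hi hj hl) =
      PowerSeries.coeff n (transition f a i j W hi hj) • c.ev ![j, l] W (pair_le hj hl) +
        if n = 0 then c.ev ![i, j] W (pair_le hi hj) - c.ev ![i, l] W (pair_le hi hl) else 0 := by
  rcases eq_or_ne n 0 with rfl | hn
  · rw [twistedD_zero, coeff_zero_transition, one_smul, if_pos rfl, ev_cechD, Fin.sum_univ_three]
    simp only [Fin.val_zero, pow_zero, one_smul, Fin.val_one, pow_one, neg_smul, Fin.val_two,
      neg_one_sq]
    rw [ev_congr c (i' := ![j, l]) (by ext m; fin_cases m <;> rfl) W _ (pair_le hj hl),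
      ev_congr c (i := ![i, j, l] ∘ Fin.succAbove 1) (i' := ![i, l])
        (by ext m; fin_cases m <;> rfl) W _ (pair_le hi hl),
      ev_congr c (i := ![i, j, l] ∘ Fin.succAbove 2) (i' := ![i, j])
        (by ext m; fin_cases m <;> rfl) W _ (pair_le hi hj)]
    abel
  · rw [twistedD, if_neg hn, if_neg hn, add_zero, add_zero, ev_cup₁]
    exact congrArg₂ (· • ·) (ev_expCoeff f a n i j W hi hj)
      (ev_congr c (by ext m; fin_cases m <;> rfl) W _ _)

lemma sum_ite_fst_eq_zero {M : Type} [AddCommGroup M] (n : ℕ) (g : ℕ → M) :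
    ∑ p ∈ antidiagonal n, (if p.1 = 0 then g p.2 else 0) = g n := by
  rw [Finset.sum_eq_single (0, n)]
  · simp
  · rintro ⟨p, q⟩ hp hne
    refine if_neg fun h0 : p = 0 ↦ hne ?_
    subst h0
    exact Prod.ext rfl (by simpa using hp)
  · simp

lemma sum_ite_snd_eq_zero {M : Type} [AddCommGroup M] (n : ℕ) (g : ℕ → M) :
    ∑ p ∈ antidiagonal n, (if p.2 = 0 then g p.1 else 0) = g n := by
  rw [← Finset.Nat.sum_antidiagonal_swap]
  exact sum_ite_fst_eq_zero n g

/-- With `g = exp(t a)`, the value at `(i, j, l)` is `g(i, j) (g(j, l) c(l) - c(j)) + (g(i, j) c(j)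
- c(i)) - (g(i, l) c(l) - c(i))`. Everything cancels except `(g(i, j) g(j, l) - g(i, l)) c(l)`,
which is zero by `transition_mul`. -/
lemma twistedD_twistedD (n : ℕ) (c : Cochain U L 0) :
    ∑ p ∈ antidiagonal n, twistedD f a L 1 p.1 (twistedD f a L 0 p.2 c) = 0 := by
  funext x
  obtain ⟨i, j, l, rfl⟩ : ∃ i j l, x = ![i, j, l] :=
    ⟨x 0, x 1, x 2, by ext m; fin_cases m <;> rfl⟩
  rw [eq_ev (∑ p ∈ antidiagonal n, _) ![i, j, l], ev_sum]
  have hi : (⨅ m, U (![i, j, l] m)) ≤ U i := iInf_le (fun m ↦ U (![i, j, l] m)) 0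
  have hj : (⨅ m, U (![i, j, l] m)) ≤ U j := iInf_le (fun m ↦ U (![i, j, l] m)) 1
  have hl : (⨅ m, U (![i, j, l] m)) ≤ U l := iInf_le (fun m ↦ U (![i, j, l] m)) 2
  simp only [ev_twistedD_one f a _ _ i j l _ hi hj hl, ev_twistedD_zero f a _ _ _ _ _ hi hj,
    ev_twistedD_zero f a _ _ _ _ _ hi hl, ev_twistedD_zero f a _ _ _ _ _ hj hl,
    sub_sub_sub_cancel_right]
  rw [Finset.sum_add_distrib, sum_ite_fst_eq_zero n fun q ↦
    PowerSeries.coeff q (transition f a i j _ hi hj) • c.ev (fun _ ↦ j) _ (fun _ ↦ hj) -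
      PowerSeries.coeff q (transition f a i l _ hi hl) • c.ev (fun _ ↦ l) _ (fun _ ↦ hl)]
  simp only [smul_sub, Finset.sum_sub_distrib, smul_ite, smul_zero]
  rw [sum_ite_snd_eq_zero n fun q ↦ PowerSeries.coeff q (transition f a i j _ hi hj) •
    c.ev (fun _ ↦ j) _ (fun _ ↦ hj)]
  simp only [← mul_smul]
  -- The convolution of coefficients is the `n`-th coefficient of `g(i, j) g(j, l) = g(i, l)`.
  rw [← Finset.sum_smul, ← PowerSeries.coeff_mul, ← transition_mul]
  change _ = (0 : Γ(L, _))
  abel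

end TwistedDifferential

/-! ### From closed formal cochains to sections, and from cohomology classes to cochains. -/

section Lift

variable {X : Scheme.{0}} {ι : Type} {U : ι → X.Opens}
  (f : X ⟶ Spec (.of ℂ)) (a : cocycles U (structureModule X) 1) {L : X.Modules}

/-- The global section of `L ⊗ exp(t v)` defined by a formal `0`-cochain which is closed for the
twisted differential. -/
def twistOfCochain (S : ℕ → Cochain U L 0) (hS : formalMap (twistedD f a L 0) S = 0) :
    twist f a L ⊤ :=
  ⟨fun i n ↦ (S n).ev (fun _ ↦ i) (⊤ ⊓ U i) fun _ ↦ inf_le_right, fun i j ↦ by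
    funext n
    have h := congrArg (fun c : Cochain U L 1 ↦ c.ev ![i, j] (⊤ ⊓ (U i ⊓ U j))
      (pair_le (inf_le_right.trans inf_le_left) (inf_le_right.trans inf_le_right)))
      (congrFun hS n)
    simp only [formalMap_apply, ev_sum, Pi.zero_apply, ev_zero] at h
    rw [Finset.sum_congr rfl fun p _ ↦ ev_twistedD_zero f a p.1 (S p.2) i j _ _ _,
      Finset.sum_sub_distrib] at h
    rw [sum_ite_fst_eq_zero n fun q ↦ (S q).ev (fun _ ↦ i) _ _, sub_eq_zero] at h
    rw [formal_smul_apply]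
    change res L _ ((S n).ev _ _ _) = ∑ p ∈ antidiagonal n, _ • res L _ ((S p.2).ev _ _ _)
    simp only [res_ev]
    exact h.symm⟩

lemma twistSpecialize_twistOfCochain (hU : ⨆ i, U i = ⊤) (S : ℕ → Cochain U L 0)
    (hS : formalMap (twistedD f a L 0) S = 0) (s : Γ(L, ⊤))
    (hs : S 0 = fun _ ↦ res L le_top s) :
    twistSpecialize f a L hU ⊤ (twistOfCochain f a S hS) = s := by
  refine eq_of_cover L hU fun i ↦ ?_
  rw [res_twistSpecialize]
  change (S 0).ev (fun _ ↦ i) (⊤ ⊓ U i) (fun _ ↦ inf_le_right) = _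
  rw [hs]
  exact res_res L _ _ _

lemma cup_cls {k : ℕ} (c : cocycles U L k) :
    cup U L k (cls a) (cls c) = cls ⟨cup₁ a.1 c.1, cup₁_mem a.2 c.2⟩ := rfl

lemma cls_surjective {k : ℕ} : Function.Surjective (cls : cocycles U L k →+ H U L k) :=
  QuotientAddGroup.mk'_surjective _

/-- Transversality in degree one, in terms of cochains. -/
lemma exists_of_isTransversal (hv : IsTransversal U L (cls a) 1) (y : Cochain U L 1)
    (hy : cechD U L 1 y = 0) (hz : ∃ z, cechD U L 1 z = cup₁ a.1 y) :
    ∃ u w, cechD U L 0 u = 0 ∧ y = cup₁ a.1 u + cechD U L 0 w := by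
  have hex : Function.Exact (cup U L 0 (cls a)) (cup U L 1 (cls a)) := hv
  let y' : cocycles U L 1 := ⟨y, hy⟩
  -- A primitive of `a ∪ y` is exactly a witness that `v ∪ [y]` vanishes in `H²`.
  have h0 : cup U L 1 (cls a) (cls y') = 0 := (cls_eq_zero _).2 hz
  obtain ⟨x, hx⟩ := (hex _).1 h0
  obtain ⟨u, rfl⟩ := cls_surjective x
  rw [cup_cls, eq_comm, ← sub_eq_zero, ← map_sub] at hx
  -- Equality of the classes of `y` and `a ∪ u` provides `w` with Čech differential `y - a ∪ u`.
  obtain ⟨w, hw⟩ := (cls_eq_zero _).1 hx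
  refine ⟨u.1, w, u.2, ?_⟩
  rw [hw]
  exact (add_sub_cancel (cup₁ a.1 u.1) y).symm

end Lift

end FormalLift

end

theorem mainTheorem2 {X : Scheme.{0}} (f : X ⟶ Spec (.of ℂ)) (hX : IsSmoothProjectiveVariety f)
    {ι : Type} (U : ι → X.Opens) (hUaff : ∀ i, IsAffineOpen (U i)) (hU : ⨆ i, U i = ⊤)
    (L : X.Modules) (hL : IsLineBundle L) (s : Γ(L, ⊤)) (hs : s ≠ 0)
    (v : H U (structureModule X) 1) (hv : IsTransversal U L v 1)
    (hsv : cup U L 0 v (globalClass U L s) = 0)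
    (a : cocycles U (structureModule X) 1) (ha : cls a = v) :
    ∃ D : FormalPairDeformation L s, D.toFormalDeformation = straightLine f a L hU hL := by
  subst ha
  obtain ⟨S, hS0, hS⟩ := exists_formalMap_eq_zero (d := twistedD f a L 0) (d' := twistedD f a L 1)
    (s := fun _ ↦ res L le_top s) (twistedD_twistedD f a)
    (by simpa only [twistedD_zero, twistedD_one] using exists_of_isTransversal a hv)
    (by rw [twistedD_zero]; exact const_mem s)
    -- On representatives `s ∪ v = 0` says that `a ∪ s` is a coboundary: this is the first order
    -- lift.
    (by rw [twistedD_zero, twistedD_one]; exact (cls_eq_zero _).1 hsv)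
  -- The deformation of `L` is kept as it is and only a section is added, so the required equality
  -- is definitional.
  exact ⟨{ straightLine f a L hU hL with
      sect := twistOfCochain f a S hS
      specialize_sect := twistSpecialize_twistOfCochain f a hU S hS s hS0 }, rfl⟩
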